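/- Fix $\lambda>0$, $\tau_0>0$ and $1/2<q\le 1$. In the Gaussian white noise model, in its equivalent form of the infinite normal means model, one observes $X^n=(X^n_j)_{j\ge1}$ with $X^n_j=\theta_{0j}+n^{-1/2}\xi_j$, where the $\xi_j$ are independent standard Gaussian variables; write $P^{(n)}_{\boldsymbol\theta_0}$ for the law of $X^n$ and $\mathbb E^{(n)}_0$ for the expectation under it. Let $\Pi=\sum_k\pi(k)\Pi_k$ be the sieve prior on $\boldsymbol\theta=(\theta_j)_{j\ge1}$ for which $k\sim\mathrm{Poisson}(\lambda)$ and, given $k$, the $\theta_j$ with $j\le k$ are independent $\mathcal N(0,\tau_j^2)$ with $\tau_j^2=\tau_0 j^{-2q}$, while $\theta_j=0$ for $j>k$. Here either the value $k=0$ is kept (with $\Pi_0$ the point mass at $\boldsymbol\theta=0$), or $k$ is conditioned on $k\ge1$; the result holds in both cases. For measurable $B$ let $$\Pi(B\mid X^n)=\frac{\int_B p^{(n)}_{\boldsymbol\theta}(X^n)\,d\Pi(\boldsymbol\theta)}{\int p^{(n)}_{\boldsymbol\theta}(X^n)\,d\Pi(\boldsymbol\theta)},\qquad p^{(n)}_{\boldsymbol\theta}(x)=\exp\Big(n\sum_j\theta_jx_j-\frac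 n2\sum_j\theta_j^2\Big),$$ be the posterior distribution, where $p^{(n)}_{\boldsymbol\theta}$ is the density with respect to the law of $X^n$ under $\boldsymbol\theta_0=0$. For $\beta>1/2$ and $L_0>0$ let $\Theta_\beta(L_0)=\{\boldsymbol\theta:\sum_{j\ge1}\theta_j^2j^{2\beta}<L_0\}$. Then the posterior contracts in $l^2$ adaptively over these Sobolev balls: for all $L_0>0$ and all $\beta_2\ge\beta_1>1/2$ there are $\epsilon_0>0$ (not depending on $\beta$) and $M_0>0$ such that for every $M\ge M_0$ $$\sup_{\beta_1\le\beta\le\beta_2}\ \sup_{\boldsymbol\theta_0\in\Theta_\beta(L_0)}\mathbb E^{(n)}_0\,\Pi\Big(\boldsymbol\theta:\ \|\boldsymbol\theta-\boldsymbol\theta_0\|_2^2\ge M\,\epsilon_n^2(\beta)\ \Big|\ X^n\Big)\longrightarrow0\quad(n\to\infty),\qquad \epsilon_n(\beta)=\epsilon_0\Big(\frac{\log n}{n}\Big)^{\beta/(2\beta+1)}.$$ -/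

import Mathlib

open MeasureTheory ProbabilityTheory Filter Topology
open scoped ENNReal NNReal

noncomputable section

namespace WhiteNoise

/-- Real sequences `(θ_1, θ_2, …)`; the coordinate `θ_j` with `j ≥ 1` is stored at index `j - 1`,
so the index `i : ℕ` stands for `j = i + 1`. Both parameters and observations are sequences. -/
abbrev Seq : Type := ℕ → ℝ

/-- The law of the observation `X^n` in the infinite normal means form of the Gaussian white noise
model: `X_j = θ_j + n^{-1/2} ξ_j` with independent standard Gaussian `ξ_j`, that is, independent
coordinates `X_j ∼ N(θ_j, 1/n)`. -/
def model (n : ℕ) (θ : Seq) : Measure Seq :=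
  Measure.infinitePi fun i => gaussianReal (θ i) ((n : ℝ≥0)⁻¹)

/-- The density `p_θ` of `model n θ` with respect to the dominating measure `model n 0`, namely
`exp (n ⟨θ, x⟩ - (n / 2) ‖θ‖²)`. It is used for the finitely supported `θ` charged by the prior,
for which both series are finite sums. -/
def likelihood (n : ℕ) (θ x : Seq) : ℝ≥0∞ :=
  ENNReal.ofReal (Real.exp (n * ∑' i, θ i * x i - n / 2 * ∑' i, θ i ^ 2))

/-- The conditional prior `Π_k`: independent coordinates, `θ_j ∼ N(0, τ_j²)` for `j ≤ k` with
`τ_j² = τ₀ j^{-2 q}`, and `θ_j = 0` for `j > k` (the Gaussian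
law with variance `0` is the point mass at its mean). -/
def conditionalPrior (τ₀ q : ℝ) (k : ℕ) : Measure Seq :=
  Measure.infinitePi fun i =>
    gaussianReal 0 (if i < k then Real.toNNReal (τ₀ * ((i : ℝ) + 1) ^ (-2 * q)) else 0)

/-- The sieve prior `Π = ∑_k π(k) Π_k`, where `π` is the prior of the threshold `k`. -/
def sievePrior (π : Measure ℕ) (τ₀ q : ℝ) : Measure Seq :=
  Measure.sum fun k => π {k} • conditionalPrior τ₀ q k

/-- The posterior probability `Π(B | x) = ∫_B p_θ(x) dΠ(θ) / ∫ p_θ(x) dΠ(θ)` under the prior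
`Π = P`. -/
def posterior (n : ℕ) (P : Measure Seq) (x : Seq) (B : Set Seq) : ℝ≥0∞ :=
  (∫⁻ θ in B, likelihood n θ x ∂P) / ∫⁻ θ, likelihood n θ x ∂P

/-- The squared `l²` distance `‖θ - θ'‖₂²`, with values in `[0, ∞]`. -/
def l2DistSq (θ θ' : Seq) : ℝ≥0∞ :=
  ∑' i, ENNReal.ofReal ((θ i - θ' i) ^ 2)

/-- The Sobolev ball `Θ_β(L₀) = {θ : ∑_j θ_j² j^{2 β} < L₀}`. -/
def sobolevBall (β L₀ : ℝ) : Set Seq :=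
  {θ | Summable (fun i : ℕ => θ i ^ 2 * ((i : ℝ) + 1) ^ (2 * β)) ∧
    ∑' i : ℕ, θ i ^ 2 * ((i : ℝ) + 1) ^ (2 * β) < L₀}

/-- The rate `ε_n(β) = ε₀ (log n / n)^{β / (2 β + 1)}`. -/
def rate (ε₀ β : ℝ) (n : ℕ) : ℝ :=
  ε₀ * (Real.log n / n) ^ (β / (2 * β + 1))

end WhiteNoise

end

noncomputable section

namespace WhiteNoise

/-! With `r = (n / log n)^{1/(2β+1)}`, squared bias and complexity balance: `n r^{-2β} = r log n =
l`, which is `n` times the squared rate. Gaussian exponential moments replace tests and entropy, in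
three estimates with a cutoff `K` of order `r`. Evidence: unless the noise in the first `K`
coordinates is atypically large, the prior with `⌈r⌉` active coordinates, restricted to a box of
half-side `1/n` around `θ₀`, keeps the denominator above `e^{-C₁ l}` times the likelihood of `θ₀` on
those coordinates (`evidence_ge`). Thresholds up to `K`: if `x` is near `θ₀` and `θ` is far from it,
then `x` is far from `θ`. Weighted by the likelihood ratio, this is an event of exponentially small
probability under `θ` itself (`setLIntegral_likelihood_le`). Thresholds above `K`: the Poisson tail
at `k ≥ A r` is `exp(-c k log n)`, which beats `e^{C₁ l}` once `A` is large (`poisson_weight_le`).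
`lintegral_posterior_le` combines the three for arbitrary constants, and
`exists_lintegral_posterior_le` chooses constants uniform in `β` and `θ₀`. -/

/-! ### Gaussian exponential moments in one coordinate. -/

lemma lintegral_prod_infinitePi (μ : ℕ → Measure ℝ) [∀ i, IsProbabilityMeasure (μ i)]
    (s : Finset ℕ) {f : ℕ → ℝ → ℝ≥0∞} (hf : ∀ i, Measurable (f i)) :
    ∫⁻ x, ∏ i ∈ s, f i (x i) ∂(Measure.infinitePi μ) = ∏ i ∈ s, ∫⁻ y, f i y ∂(μ i) := by
  have hind : iIndepFun (fun (i : ℕ) (x : ℕ → ℝ) => f i (x i)) (Measure.infinitePi μ) :=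
    iIndepFun_infinitePi (fun i => hf i)
  rw [lintegral_prod_eq_prod_lintegral_of_indepFun s _ hind
    (fun i => (hf i).comp (measurable_pi_apply i))]
  refine Finset.prod_congr rfl fun i _ => ?_
  exact (measurePreserving_eval_infinitePi μ i).lintegral_comp (hf i)

/-- The logarithm of the density of `N(b, 1/n)` with respect to `N(a, 1/n)`. -/
def logDensity (n : ℕ) (a b x : ℝ) : ℝ := n * (b - a) * x - n / 2 * (b ^ 2 - a ^ 2)

@[fun_prop]
lemma measurable_logDensity (n : ℕ) {α : Type*} [MeasurableSpace α] {f g h : α → ℝ}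
    (hf : Measurable f) (hg : Measurable g) (hh : Measurable h) :
    Measurable fun y => logDensity n (f y) (g y) (h y) := by
  unfold logDensity; fun_prop

lemma lintegral_exp_logDensity {n : ℕ} (hn : n ≠ 0) (a b c : ℝ) :
    ∫⁻ x, ENNReal.ofReal (Real.exp (logDensity n a b x)) ∂(gaussianReal c (n : ℝ≥0)⁻¹) =
      ENNReal.ofReal (Real.exp (n * (b - a) * (c - a))) := by
  have hn' : (n : ℝ) ≠ 0 := by exact_mod_cast hn
  have h1 : ∀ x : ℝ, Real.exp (logDensity n a b x) =
      Real.exp (-(n / 2 * (b ^ 2 - a ^ 2))) * Real.exp (n * (b - a) * x) := fun x => by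
    rw [← Real.exp_add, logDensity]; ring_nf
  have hint : Integrable (fun x => Real.exp (n * (b - a) * x)) (gaussianReal c (n : ℝ≥0)⁻¹) :=
    integrable_exp_mul_gaussianReal _
  have hm := mgf_gaussianReal (μ := c) (v := (n : ℝ≥0)⁻¹) (p := gaussianReal c (n : ℝ≥0)⁻¹)
    (X := id) (by simp) (n * (b - a))
  simp only [mgf, id] at hm
  simp_rw [h1]
  rw [← ofReal_integral_eq_lintegral_ofReal (hint.const_mul _) (ae_of_all _ fun x => by positivity),
    integral_const_mul, hm, ← Real.exp_add]
  congr 2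
  push_cast
  field_simp
  ring

/-- Tilting by the log density moves the mean from `a` to `b`; the factor `n / 4` is half the
Gaussian exponent, so the product is `√2` times the density of `N(b, 2/n)`. The bound `√2 ≤ e` is
merely convenient. -/
lemma lintegral_exp_sq_add_logDensity_le {n : ℕ} (hn : n ≠ 0) (a b : ℝ) :
    ∫⁻ x, ENNReal.ofReal (Real.exp (n / 4 * (x - b) ^ 2 + logDensity n a b x))
      ∂(gaussianReal a (n : ℝ≥0)⁻¹) ≤ ENNReal.ofReal (Real.exp 1) := by
  have hn' : (0 : ℝ) < n := by exact_mod_cast Nat.pos_of_ne_zero hn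
  have hv : (n : ℝ≥0)⁻¹ ≠ 0 := by simpa using hn
  have hv2 : 2 * (n : ℝ≥0)⁻¹ ≠ 0 := by simpa using hn
  rw [gaussianReal_of_var_ne_zero _ hv, lintegral_withDensity_eq_lintegral_mul _
    (measurable_gaussianPDF _ _) (by fun_prop)]
  have key : ∀ x : ℝ, (gaussianPDF a (n : ℝ≥0)⁻¹ * fun x => ENNReal.ofReal
      (Real.exp (n / 4 * (x - b) ^ 2 + logDensity n a b x))) x =
      ENNReal.ofReal (Real.sqrt 2) * gaussianPDF b (2 * (n : ℝ≥0)⁻¹) x := fun x => by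
    simp only [Pi.mul_apply, gaussianPDF]
    rw [← ENNReal.ofReal_mul (gaussianPDFReal_nonneg _ _ _), ← ENNReal.ofReal_mul (by positivity)]
    congr 1
    simp only [gaussianPDFReal, logDensity]
    push_cast
    rw [show 2 * Real.pi * (2 * (n : ℝ)⁻¹) = 2 * (2 * Real.pi * (n : ℝ)⁻¹) by ring,
      Real.sqrt_mul (by norm_num : (0:ℝ) ≤ 2) (2 * Real.pi * (n : ℝ)⁻¹), mul_inv, mul_assoc,
      ← Real.exp_add, ← mul_assoc, ← mul_assoc, mul_inv_cancel₀ (by positivity), one_mul]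
    congr 2
    field_simp
    ring
  simp_rw [key]
  rw [lintegral_const_mul _ (measurable_gaussianPDF _ _), lintegral_gaussianPDF_eq_one _ hv2, mul_one]
  refine ENNReal.ofReal_le_ofReal ?_
  have h2 : Real.sqrt 2 ≤ 2 := by
    rw [Real.sqrt_le_left (by norm_num)]; norm_num
  have := Real.add_one_le_exp (1 : ℝ)
  linarith

/-! ### Likelihood ratios on finitely many coordinates. -/

/-- The likelihood ratio of `θ` to `η` based on the first `k` coordinates of the observation. -/
def likelihoodRatio (n k : ℕ) (η θ x : Seq) : ℝ≥0∞ :=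
  ENNReal.ofReal (Real.exp (∑ i ∈ Finset.range k, logDensity n (η i) (θ i) (x i)))

instance (n : ℕ) (θ : Seq) : IsProbabilityMeasure (model n θ) := by
  unfold model; infer_instance

instance (τ₀ q : ℝ) (k : ℕ) : IsProbabilityMeasure (conditionalPrior τ₀ q k) := by
  unfold conditionalPrior; infer_instance

@[fun_prop]
lemma measurable_likelihoodRatio (n k : ℕ) {α : Type*} [MeasurableSpace α] {f g h : α → Seq}
    (hf : Measurable f) (hg : Measurable g) (hh : Measurable h) :
    Measurable fun y => likelihoodRatio n k (f y) (g y) (h y) := by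
  unfold likelihoodRatio; fun_prop

lemma likelihoodRatio_mul (n k : ℕ) (ζ η θ x : Seq) :
    likelihoodRatio n k ζ η x * likelihoodRatio n k η θ x = likelihoodRatio n k ζ θ x := by
  unfold likelihoodRatio
  rw [← ENNReal.ofReal_mul (Real.exp_nonneg _), ← Real.exp_add, ← Finset.sum_add_distrib]
  congr 3
  ext i
  unfold logDensity
  ring

lemma likelihoodRatio_mono_range {n k K : ℕ} (hk : k ≤ K) {η θ : Seq}
    (h : ∀ i, k ≤ i → θ i = η i) (x : Seq) :
    likelihoodRatio n K η θ x = likelihoodRatio n k η θ x := by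
  unfold likelihoodRatio
  congr 2
  symm
  refine Finset.sum_subset (Finset.range_subset_range.2 hk) fun i _ hi => ?_
  rw [h i (by simpa using hi)]
  simp [logDensity]

lemma likelihood_eq_likelihoodRatio {k : ℕ} {θ : Seq} (h : ∀ i, k ≤ i → θ i = 0) (n : ℕ) (x : Seq) :
    likelihood n θ x = likelihoodRatio n k 0 θ x := by
  unfold likelihood likelihoodRatio
  rw [tsum_eq_sum (s := Finset.range k) (fun i hi => by rw [h i (by simpa using hi)]; ring),
    tsum_eq_sum (s := Finset.range k) (fun i hi => by rw [h i (by simpa using hi)]; ring),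
    Finset.mul_sum, Finset.mul_sum, ← Finset.sum_sub_distrib]
  congr 3
  ext i
  simp [logDensity]
  ring

lemma ae_conditionalPrior_eq_zero (τ₀ q : ℝ) (k : ℕ) :
    ∀ᵐ θ ∂(conditionalPrior τ₀ q k), ∀ i, k ≤ i → θ i = 0 := by
  rw [ae_all_iff]
  intro i
  by_cases hi : k ≤ i
  · have h0 : (conditionalPrior τ₀ q k) ((fun θ : Seq => θ i) ⁻¹' {0}ᶜ) = 0 := by
      unfold conditionalPrior
      rw [(measurePreserving_eval_infinitePi _ i).measure_preimage
        (MeasurableSet.singleton _).compl.nullMeasurableSet]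
      simp [not_lt.2 hi]
    rw [ae_iff]
    convert h0 using 2
    ext θ
    simp [hi]
  · simp [hi]

lemma likelihoodRatio_eq_prod (n k : ℕ) (η θ x : Seq) :
    likelihoodRatio n k η θ x =
      ∏ i ∈ Finset.range k, ENNReal.ofReal (Real.exp (logDensity n (η i) (θ i) (x i))) := by
  unfold likelihoodRatio
  rw [Real.exp_sum, ENNReal.ofReal_prod_of_nonneg fun i _ => Real.exp_nonneg _]

/-- Two cases matter: `η = θ₀` gives mean one, and `η = truncate K θ₀`, `θ = θ₀` gives the
exponential of `n` times the squared bias beyond `K`. -/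
lemma lintegral_likelihoodRatio {n : ℕ} (hn : n ≠ 0) (k : ℕ) (η θ θ₀ : Seq) :
    ∫⁻ x, likelihoodRatio n k η θ x ∂(model n θ₀) =
      ENNReal.ofReal (Real.exp (n * ∑ i ∈ Finset.range k, (θ i - η i) * (θ₀ i - η i))) := by
  simp_rw [likelihoodRatio_eq_prod]
  unfold model
  rw [lintegral_prod_infinitePi _ _
    (f := fun i y => ENNReal.ofReal (Real.exp (logDensity n (η i) (θ i) y))) (fun i => by fun_prop)]
  simp_rw [lintegral_exp_logDensity hn]
  rw [← ENNReal.ofReal_prod_of_nonneg fun i _ => Real.exp_nonneg _, ← Real.exp_sum, Finset.mul_sum]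
  congr 3
  ext i
  ring

lemma lintegral_likelihoodRatio_self {n : ℕ} (hn : n ≠ 0) (k : ℕ) (θ θ₀ : Seq) :
    ∫⁻ x, likelihoodRatio n k θ₀ θ x ∂(model n θ₀) = 1 := by
  rw [lintegral_likelihoodRatio hn]; simp

/-- The exponential of `n / 4` times the squared distance of `x` and `θ` in the first `k`
coordinates. -/
def expSqDist (n k : ℕ) (θ x : Seq) : ℝ≥0∞ :=
  ENNReal.ofReal (Real.exp (n / 4 * ∑ i ∈ Finset.range k, (x i - θ i) ^ 2))

@[fun_prop]
lemma measurable_expSqDist (n k : ℕ) {α : Type*} [MeasurableSpace α] {f g : α → Seq}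
    (hf : Measurable f) (hg : Measurable g) :
    Measurable fun y => expSqDist n k (f y) (g y) := by
  unfold expSqDist; fun_prop

lemma lintegral_expSqDist_mul_likelihoodRatio_le {n : ℕ} (hn : n ≠ 0) (k : ℕ) (θ θ₀ : Seq) :
    ∫⁻ x, expSqDist n k θ x * likelihoodRatio n k θ₀ θ x ∂(model n θ₀) ≤
      ENNReal.ofReal (Real.exp k) := by
  have h1 : ∀ x, expSqDist n k θ x * likelihoodRatio n k θ₀ θ x =
      ∏ i ∈ Finset.range k, ENNReal.ofReal
        (Real.exp (n / 4 * (x i - θ i) ^ 2 + logDensity n (θ₀ i) (θ i) (x i))) := fun x => by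
    rw [← ENNReal.ofReal_prod_of_nonneg fun i _ => Real.exp_nonneg _, ← Real.exp_sum,
      Finset.sum_add_distrib, Real.exp_add, ENNReal.ofReal_mul (Real.exp_nonneg _),
      ← Finset.mul_sum]
    rfl
  simp_rw [h1]
  unfold model
  rw [lintegral_prod_infinitePi _ _ (f := fun i y => ENNReal.ofReal
    (Real.exp (n / 4 * (y - θ i) ^ 2 + logDensity n (θ₀ i) (θ i) y))) (fun i => by fun_prop)]
  refine (Finset.prod_le_pow_card _ _ _ fun i _ => lintegral_exp_sq_add_logDensity_le hn _ _).trans ?_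
  rw [Finset.card_range, ← ENNReal.ofReal_pow (Real.exp_nonneg _), ← Real.exp_nat_mul, mul_one]

lemma lintegral_expSqDist_le {n : ℕ} (hn : n ≠ 0) (k : ℕ) (θ₀ : Seq) :
    ∫⁻ x, expSqDist n k θ₀ x ∂(model n θ₀) ≤ ENNReal.ofReal (Real.exp k) := by
  have h := lintegral_expSqDist_mul_likelihoodRatio_le hn k θ₀ θ₀
  simpa [likelihoodRatio, logDensity] using h

/-! ### Expected posterior mass in terms of evidence, separation and tail weights. -/

/-- Separates two dependent random factors whose expectations are known individually but not for
their product. -/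
lemma le_add_of_le_one_of_le_mul {u a b : ℝ≥0∞} (h1 : u ≤ 1) (h2 : u ≤ a * b) : u ≤ a + b := by
  rcases le_total 1 a with ha | ha
  · exact h1.trans (ha.trans le_self_add)
  · calc u ≤ a * b := h2
      _ ≤ 1 * b := by gcongr
      _ ≤ a + b := by rw [one_mul]; exact le_add_self

lemma lintegral_sievePrior (π : Measure ℕ) (τ₀ q : ℝ) (f : Seq → ℝ≥0∞) :
    ∫⁻ θ, f θ ∂(sievePrior π τ₀ q) = ∑' k, π {k} * ∫⁻ θ, f θ ∂(conditionalPrior τ₀ q k) := by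
  simp only [sievePrior, lintegral_sum_measure, lintegral_smul_measure, smul_eq_mul]

lemma setLIntegral_sievePrior (π : Measure ℕ) (τ₀ q : ℝ) (f : Seq → ℝ≥0∞) (B : Set Seq) :
    ∫⁻ θ in B, f θ ∂(sievePrior π τ₀ q) =
      ∑' k, π {k} * ∫⁻ θ in B, f θ ∂(conditionalPrior τ₀ q k) := by
  simp only [sievePrior, Measure.restrict_sum_of_countable, lintegral_sum_measure,
    Measure.restrict_smul, lintegral_smul_measure, smul_eq_mul]

lemma posterior_le_one (n : ℕ) (P : Measure Seq) (x : Seq) (B : Set Seq) :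
    posterior n P x B ≤ 1 := by
  refine ENNReal.div_le_of_le_mul ?_
  rw [one_mul]
  exact setLIntegral_le_lintegral _ _

/-- The sequence `θ` with the coordinates from `K` on replaced by zero. -/
def truncate (K : ℕ) (θ : Seq) : Seq := fun i => if i < K then θ i else 0

lemma likelihoodRatio_truncate (n K : ℕ) (η θ x : Seq) :
    likelihoodRatio n K η (truncate K θ) x = likelihoodRatio n K η θ x := by
  unfold likelihoodRatio
  congr 2
  refine Finset.sum_congr rfl fun i hi => ?_
  rw [truncate, if_pos (Finset.mem_range.1 hi)]

lemma lintegral_likelihood_conditionalPrior (n : ℕ) (τ₀ q : ℝ) (k : ℕ) (θ₀ x : Seq) :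
    ∫⁻ θ, likelihood n θ x ∂(conditionalPrior τ₀ q k) =
      likelihoodRatio n k 0 θ₀ x *
        ∫⁻ θ, likelihoodRatio n k θ₀ θ x ∂(conditionalPrior τ₀ q k) := by
  rw [← lintegral_const_mul _ (by fun_prop)]
  refine lintegral_congr_ae ?_
  filter_upwards [ae_conditionalPrior_eq_zero τ₀ q k] with θ hθ
  rw [likelihood_eq_likelihoodRatio hθ, likelihoodRatio_mul]

/-- A Chernoff weight in place of a test: on `B` the factor `e^{-Y} * expSqDist` is at least one, so
inserting it only increases the integral. Its mean against the likelihood ratio is at most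
`e^{K-Y}`. -/
lemma setLIntegral_likelihood_le {n K k : ℕ} (hk : k ≤ K) (τ₀ q : ℝ) {B : Set Seq}
    (hBm : MeasurableSet B) {θ₀ x : Seq} {Y : ℝ}
    (hB : ∀ θ ∈ B, (∀ i, K ≤ i → θ i = 0) →
      Y ≤ n / 4 * ∑ i ∈ Finset.range K, (x i - θ i) ^ 2) :
    ∫⁻ θ in B, likelihood n θ x ∂(conditionalPrior τ₀ q k) ≤
      likelihoodRatio n K 0 θ₀ x * (ENNReal.ofReal (Real.exp (-Y)) *
        ∫⁻ θ, expSqDist n K θ x * likelihoodRatio n K θ₀ θ x ∂(conditionalPrior τ₀ q k)) := by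
  have hm : Measurable fun θ => expSqDist n K θ x * likelihoodRatio n K θ₀ θ x := by fun_prop
  rw [← lintegral_const_mul _ hm, ← lintegral_const_mul _ (hm.const_mul _)]
  refine le_trans ?_ (setLIntegral_le_lintegral B _)
  refine lintegral_mono_ae ?_
  filter_upwards [ae_restrict_mem hBm, ae_restrict_of_ae (ae_conditionalPrior_eq_zero τ₀ q k)]
    with θ hθB hθ
  have hθK : ∀ i, K ≤ i → θ i = 0 := fun i hi => hθ i (hk.trans hi)
  have h1 : 1 ≤ ENNReal.ofReal (Real.exp (-Y)) * expSqDist n K θ x := by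
    unfold expSqDist
    rw [← ENNReal.ofReal_mul (Real.exp_nonneg _), ← Real.exp_add, ENNReal.one_le_ofReal,
      Real.one_le_exp_iff]
    linarith [hB θ hθB hθK]
  rw [likelihood_eq_likelihoodRatio hθK, ← likelihoodRatio_mul n K 0 θ₀ θ x]
  gcongr
  calc likelihoodRatio n K θ₀ θ x = 1 * likelihoodRatio n K θ₀ θ x := (one_mul _).symm
    _ ≤ ENNReal.ofReal (Real.exp (-Y)) * expSqDist n K θ x * likelihoodRatio n K θ₀ θ x := by gcongr
    _ = _ := mul_assoc _ _ _

lemma measurable_lintegral_likelihoodRatio (n k : ℕ) (θ₀ : Seq) (μ : Measure Seq) [SFinite μ] :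
    Measurable fun x => ∫⁻ θ, likelihoodRatio n k θ₀ θ x ∂μ :=
  Measurable.lintegral_prod_right' (f := fun p : Seq × Seq => likelihoodRatio n k θ₀ p.2 p.1)
    (by fun_prop)

lemma measurable_lintegral_expSqDist_mul (n k : ℕ) (θ₀ : Seq) (μ : Measure Seq) [SFinite μ] :
    Measurable fun x => ∫⁻ θ, expSqDist n k θ x * likelihoodRatio n k θ₀ θ x ∂μ :=
  Measurable.lintegral_prod_right'
    (f := fun p : Seq × Seq => expSqDist n k p.2 p.1 * likelihoodRatio n k θ₀ p.2 p.1)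
    (by fun_prop)

lemma lintegral_lintegral_likelihoodRatio {n : ℕ} (hn : n ≠ 0) (k : ℕ) (θ₀ : Seq) (μ : Measure Seq)
    [IsProbabilityMeasure μ] :
    ∫⁻ x, ∫⁻ θ, likelihoodRatio n k θ₀ θ x ∂μ ∂(model n θ₀) = 1 := by
  rw [lintegral_lintegral_swap (Measurable.aemeasurable (by unfold Function.uncurry; fun_prop))]
  simp [lintegral_likelihoodRatio_self hn]

lemma lintegral_lintegral_expSqDist_mul_le {n : ℕ} (hn : n ≠ 0) (k : ℕ) (θ₀ : Seq)
    (μ : Measure Seq) [IsProbabilityMeasure μ] :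
    ∫⁻ x, ∫⁻ θ, expSqDist n k θ x * likelihoodRatio n k θ₀ θ x ∂μ ∂(model n θ₀) ≤
      ENNReal.ofReal (Real.exp k) := by
  rw [lintegral_lintegral_swap (Measurable.aemeasurable (by unfold Function.uncurry; fun_prop))]
  refine (lintegral_mono fun θ => lintegral_expSqDist_mul_likelihoodRatio_le hn k θ θ₀).trans ?_
  simp

/-- A bound of the numerator of the posterior given the threshold `k`, relative to the evidence. -/
def posteriorMajorant (n : ℕ) (π : Measure ℕ) (τ₀ q : ℝ) (θ₀ : Seq) (K : ℕ) (E Y C : ℝ) (s : ℕ → ℝ)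
    (k : ℕ) (x : Seq) : ℝ≥0∞ :=
  if K < k then
    ENNReal.ofReal (s k) * ∫⁻ θ, likelihoodRatio n k θ₀ θ x ∂(conditionalPrior τ₀ q k) +
      ENNReal.ofReal (C * s k * Real.exp E) * likelihoodRatio n k (truncate K θ₀) θ₀ x
  else
    π {k} * (ENNReal.ofReal (Real.exp (E - Y)) *
      ∫⁻ θ, expSqDist n K θ x * likelihoodRatio n K θ₀ θ x ∂(conditionalPrior τ₀ q k))

lemma measurable_posteriorMajorant (n : ℕ) (π : Measure ℕ) (τ₀ q : ℝ) (θ₀ : Seq) (K : ℕ)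
    (E Y C : ℝ) (s : ℕ → ℝ) (k : ℕ) :
    Measurable (posteriorMajorant n π τ₀ q θ₀ K E Y C s k) := by
  unfold posteriorMajorant
  have h1 := measurable_lintegral_likelihoodRatio n k θ₀ (conditionalPrior τ₀ q k)
  have h2 := measurable_lintegral_expSqDist_mul n K θ₀ (conditionalPrior τ₀ q k)
  split_ifs
  · fun_prop
  · fun_prop

lemma lintegral_posteriorMajorant_le {n : ℕ} (hn : n ≠ 0) (π : Measure ℕ) (τ₀ q : ℝ) (θ₀ : Seq)
    (K : ℕ) (E Y C T : ℝ) (hC : 0 ≤ C) {s : ℕ → ℝ} (k : ℕ) (hs : K < k → 0 < s k)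
    (hT : n * ∑ i ∈ Finset.range k, (if i < K then 0 else θ₀ i ^ 2) ≤ T) :
    ∫⁻ x, posteriorMajorant n π τ₀ q θ₀ K E Y C s k x ∂(model n θ₀) ≤
      π {k} * ENNReal.ofReal (Real.exp (E + K - Y)) +
        if K < k then ENNReal.ofReal (s k * (1 + C * Real.exp (E + T))) else 0 := by
  unfold posteriorMajorant
  split_ifs with hk
  · have hs := hs hk
    refine le_trans ?_ le_add_self
    rw [lintegral_add_right _ (by fun_prop),
      lintegral_const_mul _ (measurable_lintegral_likelihoodRatio n k θ₀ _),
      lintegral_const_mul _ (by fun_prop), lintegral_lintegral_likelihoodRatio hn,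
      lintegral_likelihoodRatio hn, mul_one, ← ENNReal.ofReal_mul (by positivity),
      ← ENNReal.ofReal_add hs.le (by positivity)]
    refine ENNReal.ofReal_le_ofReal ?_
    have h1 : ∀ i, (θ₀ i - truncate K θ₀ i) * (θ₀ i - truncate K θ₀ i) =
        if i < K then 0 else θ₀ i ^ 2 := fun i => by
      unfold truncate
      split_ifs <;> ring
    simp_rw [h1]
    rw [Real.exp_add E T]
    have h2 := mul_le_mul_of_nonneg_left (Real.exp_le_exp.2 hT)
      (by positivity : 0 ≤ C * s k * Real.exp E)
    linarith
  · rw [add_zero, lintegral_const_mul _ ((measurable_lintegral_expSqDist_mul n K θ₀ _).const_mul _),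
      lintegral_const_mul _ (measurable_lintegral_expSqDist_mul n K θ₀ _)]
    gcongr
    calc _ ≤ ENNReal.ofReal (Real.exp (E - Y)) * ENNReal.ofReal (Real.exp K) := by
          gcongr
          exact lintegral_lintegral_expSqDist_mul_le hn K θ₀ _
      _ = _ := by
          rw [← ENNReal.ofReal_mul (Real.exp_nonneg _), ← Real.exp_add]
          congr 2
          ring

theorem lintegral_posterior_le {n : ℕ} (hn : n ≠ 0) (π : Measure ℕ) [IsProbabilityMeasure π]
    (τ₀ q : ℝ) (θ₀ : Seq) {B : Set Seq} (hBm : MeasurableSet B) (K : ℕ) {l E Y C T : ℝ} (hC : 0 ≤ C)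
    {s : ℕ → ℝ}
    (hD : ∀ x : Seq, n * ∑ i ∈ Finset.range K, (x i - θ₀ i) ^ 2 ≤ l →
      ENNReal.ofReal (Real.exp (-E)) * likelihoodRatio n K 0 θ₀ x ≤
        ∫⁻ θ, likelihood n θ x ∂(sievePrior π τ₀ q))
    (hB : ∀ θ ∈ B, (∀ i, K ≤ i → θ i = 0) → ∀ x : Seq,
      n * ∑ i ∈ Finset.range K, (x i - θ₀ i) ^ 2 ≤ l →
        Y ≤ n / 4 * ∑ i ∈ Finset.range K, (x i - θ i) ^ 2)
    (hT : ∀ k, n * ∑ i ∈ Finset.range k, (if i < K then 0 else θ₀ i ^ 2) ≤ T)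
    (hs : ∀ k, K < k → 0 < s k ∧ π {k} ≤ ENNReal.ofReal (C * s k ^ 2)) :
    ∫⁻ x, posterior n (sievePrior π τ₀ q) x B ∂(model n θ₀) ≤
      ENNReal.ofReal (Real.exp (K - l / 4)) + ENNReal.ofReal (Real.exp (E + K - Y)) +
        ∑' k, if K < k then ENNReal.ofReal (s k * (1 + C * Real.exp (E + T))) else 0 := by
  have hpt : ∀ x, posterior n (sievePrior π τ₀ q) x B ≤
      ENNReal.ofReal (Real.exp (-(l / 4))) * expSqDist n K θ₀ x +
        ∑' k, posteriorMajorant n π τ₀ q θ₀ K E Y C s k x := by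
    intro x
    by_cases hx : n * ∑ i ∈ Finset.range K, (x i - θ₀ i) ^ 2 ≤ l
    · refine le_trans ?_ le_add_self
      unfold posterior
      rw [setLIntegral_sievePrior, div_eq_mul_inv, ← ENNReal.tsum_mul_right]
      refine ENNReal.tsum_le_tsum fun k => ?_
      set D := ∫⁻ θ, likelihood n θ x ∂(sievePrior π τ₀ q) with hDdef
      have hDx := hD x hx
      set P := likelihoodRatio n K 0 θ₀ x with hP
      have hinv : P * D⁻¹ ≤ ENNReal.ofReal (Real.exp E) := by
        rw [← div_eq_mul_inv]
        refine ENNReal.div_le_of_le_mul ?_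
        calc P = ENNReal.ofReal (Real.exp E) * (ENNReal.ofReal (Real.exp (-E)) * P) := by
              rw [← mul_assoc, ← ENNReal.ofReal_mul (Real.exp_nonneg _), ← Real.exp_add]
              simp
          _ ≤ ENNReal.ofReal (Real.exp E) * D := by gcongr
      unfold posteriorMajorant
      split_ifs with hk
      · obtain ⟨hs0, hsk⟩ := hs k hk
        -- The weight `C * s k ^ 2` is shared out as `s k` with the averaged likelihood ratio and `C
        -- * s k * exp E` with the bias factor.
        refine le_add_of_le_one_of_le_mul ?_ ?_
        · rw [← div_eq_mul_inv]
          refine ENNReal.div_le_of_le_mul ?_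
          rw [one_mul, hDdef, lintegral_sievePrior]
          refine le_trans ?_ (ENNReal.le_tsum k)
          exact mul_le_mul_right (setLIntegral_le_lintegral _ _) _
        -- The evidence bound sees only `K` coordinates; the coordinates of `θ₀` between `K` and `k`
        -- are split off through `truncate K θ₀`.
        · have h1 : likelihoodRatio n k 0 θ₀ x =
              P * likelihoodRatio n k (truncate K θ₀) θ₀ x := by
            rw [← likelihoodRatio_mul n k 0 (truncate K θ₀) θ₀ x,
              likelihoodRatio_mono_range hk.le (fun i hi => by simp [truncate, hi]),
              likelihoodRatio_truncate]
          have h2 := lintegral_likelihood_conditionalPrior n τ₀ q k θ₀ x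
          set N := ∫⁻ θ, likelihoodRatio n k θ₀ θ x ∂(conditionalPrior τ₀ q k)
          set Z := likelihoodRatio n k (truncate K θ₀) θ₀ x
          calc π {k} * (∫⁻ θ in B, likelihood n θ x ∂(conditionalPrior τ₀ q k)) * D⁻¹
              ≤ ENNReal.ofReal (C * s k ^ 2) * (P * Z * N) * D⁻¹ := by
                rw [← h1, ← h2]
                gcongr
                exact Measure.restrict_le_self
            _ = ENNReal.ofReal (C * s k ^ 2) * (Z * N) * (P * D⁻¹) := by ring
            _ ≤ ENNReal.ofReal (C * s k ^ 2) * (Z * N) * ENNReal.ofReal (Real.exp E) := by gcongr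
            _ = _ := by
                rw [show C * s k ^ 2 = s k * (C * s k) by ring, ENNReal.ofReal_mul hs0.le,
                  ENNReal.ofReal_mul (by positivity : 0 ≤ C * s k)]
                ring
      · have h1 := setLIntegral_likelihood_le (not_lt.1 hk) τ₀ q hBm (θ₀ := θ₀)
          (fun θ hθ h0 => hB θ hθ h0 x hx)
        rw [← hP] at h1
        set N := ∫⁻ θ, expSqDist n K θ x * likelihoodRatio n K θ₀ θ x ∂(conditionalPrior τ₀ q k)
        calc π {k} * (∫⁻ θ in B, likelihood n θ x ∂(conditionalPrior τ₀ q k)) * D⁻¹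
            ≤ π {k} * (P * (ENNReal.ofReal (Real.exp (-Y)) * N)) * D⁻¹ := by gcongr
          _ = π {k} * (P * D⁻¹ * ENNReal.ofReal (Real.exp (-Y)) * N) := by ring
          _ ≤ π {k} * (ENNReal.ofReal (Real.exp E) * ENNReal.ofReal (Real.exp (-Y)) * N) := by
              gcongr
          _ = _ := by
              rw [← ENNReal.ofReal_mul (Real.exp_nonneg _), ← Real.exp_add, ← sub_eq_add_neg]
    -- Large noise: the posterior is bounded by one, and the first summand of the bound exceeds one
    -- here.
    · refine (posterior_le_one _ _ _ _).trans (le_trans ?_ le_self_add)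
      unfold expSqDist
      rw [← ENNReal.ofReal_mul (Real.exp_nonneg _), ← Real.exp_add, ENNReal.one_le_ofReal,
        Real.one_le_exp_iff]
      linarith
  have htot : ∑' k, π {k} = 1 := by
    rw [← lintegral_one.trans (measure_univ (μ := π)), lintegral_countable']
    simp
  have hmeas : Measurable fun x =>
      ENNReal.ofReal (Real.exp (-(l / 4))) * expSqDist n K θ₀ x := by fun_prop
  refine (lintegral_mono hpt).trans ?_
  rw [lintegral_add_left hmeas, lintegral_tsum fun k =>
    (measurable_posteriorMajorant n π τ₀ q θ₀ K E Y C s k).aemeasurable, add_assoc]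
  refine add_le_add ?_ ?_
  · rw [lintegral_const_mul _ (by fun_prop)]
    refine (mul_le_mul_right (lintegral_expSqDist_le hn K θ₀) _).trans (le_of_eq ?_)
    rw [← ENNReal.ofReal_mul (Real.exp_nonneg _), ← Real.exp_add]
    congr 2
    ring
  · refine (ENNReal.tsum_le_tsum fun k => lintegral_posteriorMajorant_le hn π τ₀ q θ₀ K E Y C T hC k
      (fun hk => (hs k hk).1) (hT k)).trans ?_
    rw [ENNReal.tsum_add, ENNReal.tsum_mul_right, htot, one_mul]

/-! ### Lower bounds for prior mass and evidence. -/

lemma gaussianReal_Icc_ge {v : ℝ≥0} (hv : v ≠ 0) (c δ : ℝ) :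
    ENNReal.ofReal (2 * δ / Real.sqrt (2 * Real.pi * v) * Real.exp (-((c ^ 2 + δ ^ 2) / v))) ≤
      gaussianReal 0 v (Set.Icc (c - δ) (c + δ)) := by
  have hv' : (0 : ℝ) < v := by exact_mod_cast pos_iff_ne_zero.2 hv
  rw [gaussianReal_apply _ hv]
  have h1 : ∀ x ∈ Set.Icc (c - δ) (c + δ), ENNReal.ofReal
      ((Real.sqrt (2 * Real.pi * v))⁻¹ * Real.exp (-((c ^ 2 + δ ^ 2) / v))) ≤ gaussianPDF 0 v x := by
    intro x hx
    refine ENNReal.ofReal_le_ofReal ?_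
    unfold gaussianPDFReal
    gcongr
    rw [neg_div, neg_le_neg_iff, div_le_div_iff₀ (by positivity) hv']
    have h2 : (x - c) ^ 2 ≤ δ ^ 2 := sq_le_sq' (by linarith [hx.1]) (by linarith [hx.2])
    nlinarith [sq_nonneg (x - 2 * c)]
  refine le_trans ?_ (setLIntegral_mono' measurableSet_Icc h1)
  rw [setLIntegral_const, Real.volume_Icc, ← ENNReal.ofReal_mul (by positivity)]
  refine ENNReal.ofReal_le_ofReal (le_of_eq ?_)
  ring

lemma conditionalPrior_box_ge {τ₀ q : ℝ} (hτ₀ : 0 < τ₀) (hq : 0 ≤ q) (k : ℕ) (θ₀ : Seq) {δ : ℝ}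
    (hδ : 0 ≤ δ) :
    ENNReal.ofReal ((2 * δ / Real.sqrt (2 * Real.pi * τ₀)) ^ k * Real.exp
      (-((∑ i ∈ Finset.range k, (θ₀ i ^ 2 + δ ^ 2) * ((i : ℝ) + 1) ^ (2 * q)) / τ₀))) ≤
    conditionalPrior τ₀ q k
      (Set.pi (Finset.range k) fun i => Set.Icc (θ₀ i - δ) (θ₀ i + δ)) := by
  unfold conditionalPrior
  rw [Measure.infinitePi_pi _ (fun i _ => measurableSet_Icc)]
  have h0 : (2 * δ / Real.sqrt (2 * Real.pi * τ₀)) ^ k * Real.exp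
      (-((∑ i ∈ Finset.range k, (θ₀ i ^ 2 + δ ^ 2) * ((i : ℝ) + 1) ^ (2 * q)) / τ₀)) =
      ∏ i ∈ Finset.range k, (2 * δ / Real.sqrt (2 * Real.pi * τ₀) *
        Real.exp (-((θ₀ i ^ 2 + δ ^ 2) * ((i : ℝ) + 1) ^ (2 * q) / τ₀))) := by
    rw [Finset.prod_mul_distrib, Finset.prod_const, Finset.card_range, ← Real.exp_sum,
      Finset.sum_neg_distrib, Finset.sum_div]
  rw [h0, ENNReal.ofReal_prod_of_nonneg fun i _ => by positivity]
  refine Finset.prod_le_prod' fun i hi => ?_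
  rw [if_pos (Finset.mem_range.1 hi)]
  have hpos : 0 < τ₀ * ((i : ℝ) + 1) ^ (-2 * q) := by positivity
  refine le_trans (ENNReal.ofReal_le_ofReal ?_)
    (gaussianReal_Icc_ge (Real.toNNReal_pos.2 hpos).ne' (θ₀ i) δ)
  rw [Real.coe_toNNReal _ hpos.le]
  have h1 : (θ₀ i ^ 2 + δ ^ 2) / (τ₀ * ((i : ℝ) + 1) ^ (-2 * q)) =
      (θ₀ i ^ 2 + δ ^ 2) * ((i : ℝ) + 1) ^ (2 * q) / τ₀ := by
    rw [neg_mul, Real.rpow_neg (by positivity)]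
    field_simp
  rw [h1]
  have h2 : ((i : ℝ) + 1) ^ (-2 * q) ≤ 1 :=
    Real.rpow_le_one_of_one_le_of_nonpos (by linarith [(Nat.cast_nonneg i : (0 : ℝ) ≤ i)])
      (by linarith)
  have h3 : 0 < Real.sqrt (2 * Real.pi * (τ₀ * ((i : ℝ) + 1) ^ (-2 * q))) := by positivity
  gcongr
  exact mul_le_of_le_one_right hτ₀.le h2

/-- Only one threshold `k` and one box are kept. On the box `n‖θ - θ₀‖²` over the first `K`
coordinates is at most `l + T`, and the noise contributes a further `l / 2`. -/
lemma evidence_ge {n : ℕ} (π : Measure ℕ) (τ₀ q : ℝ) {k K : ℕ} (hkK : k ≤ K) (θ₀ x : Seq)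
    {l T δ : ℝ} (hx : n * ∑ i ∈ Finset.range K, (x i - θ₀ i) ^ 2 ≤ l)
    (hT : n * ∑ i ∈ Finset.range K, (if i < k then 0 else θ₀ i ^ 2) ≤ T)
    (hδ : n * (k * δ ^ 2) ≤ l) :
    π {k} * conditionalPrior τ₀ q k
        (Set.pi (Finset.range k) fun i => Set.Icc (θ₀ i - δ) (θ₀ i + δ)) *
      ENNReal.ofReal (Real.exp (-(3 / 2 * l + T))) * likelihoodRatio n K 0 θ₀ x ≤
    ∫⁻ θ, likelihood n θ x ∂(sievePrior π τ₀ q) := by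
  set S : Set Seq := Set.pi (Finset.range k) fun i => Set.Icc (θ₀ i - δ) (θ₀ i + δ) with hS
  have hSm : MeasurableSet S :=
    MeasurableSet.pi (Finset.countable_toSet _) fun i _ => measurableSet_Icc
  rw [lintegral_sievePrior]
  refine le_trans ?_ (ENNReal.le_tsum k)
  rw [mul_assoc, mul_assoc]
  gcongr
  refine le_trans ?_ (setLIntegral_le_lintegral S _)
  rw [mul_comm, ← setLIntegral_const]
  refine lintegral_mono_ae ?_
  filter_upwards [ae_restrict_mem hSm, ae_restrict_of_ae (ae_conditionalPrior_eq_zero τ₀ q k)]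
    with θ hθS hθ
  rw [likelihood_eq_likelihoodRatio (fun i hi => hθ i (hkK.trans hi)) n x,
    ← likelihoodRatio_mul n K 0 θ₀ θ x, mul_comm]
  gcongr
  unfold likelihoodRatio
  refine ENNReal.ofReal_le_ofReal (Real.exp_le_exp.2 ?_)
  -- Completing the square makes the bound deterministic in `x`, so no variance estimate of the log
  -- likelihood ratio is needed.
  have h1 : ∀ i, -(n : ℝ) * (θ i - θ₀ i) ^ 2 - n / 2 * (x i - θ₀ i) ^ 2 ≤
      logDensity n (θ₀ i) (θ i) (x i) := fun i => by
    have h2 : logDensity n (θ₀ i) (θ i) (x i) -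
        (-(n : ℝ) * (θ i - θ₀ i) ^ 2 - n / 2 * (x i - θ₀ i) ^ 2) =
        n / 2 * (θ i + x i - 2 * θ₀ i) ^ 2 := by
      unfold logDensity; ring
    have h3 : (0 : ℝ) ≤ n / 2 * (θ i + x i - 2 * θ₀ i) ^ 2 := by positivity
    linarith
  refine le_trans ?_ (Finset.sum_le_sum fun i _ => h1 i)
  rw [Finset.sum_sub_distrib, ← Finset.mul_sum, ← Finset.mul_sum]
  have h4 : ∑ i ∈ Finset.range K, (θ i - θ₀ i) ^ 2 ≤
      k * δ ^ 2 + ∑ i ∈ Finset.range K, (if i < k then 0 else θ₀ i ^ 2) := by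
    have h5 : (k : ℝ) * δ ^ 2 = ∑ i ∈ Finset.range K, (if i < k then δ ^ 2 else 0) := by
      rw [← Finset.sum_filter, Finset.sum_const, nsmul_eq_mul]
      congr 2
      rw [show (Finset.range K).filter (· < k) = Finset.range k by ext i; simp; omega,
        Finset.card_range]
    rw [h5, ← Finset.sum_add_distrib]
    refine Finset.sum_le_sum fun i _ => ?_
    split_ifs with hi
    · have h6 := hθS i (by simpa using hi)
      rw [add_zero]
      exact sq_le_sq' (by linarith [h6.1]) (by linarith [h6.2])
    · rw [hθ i (not_lt.1 hi)]
      simp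
  have h7 := mul_le_mul_of_nonneg_left h4 (Nat.cast_nonneg n : (0 : ℝ) ≤ n)
  linarith

/-! ### Sobolev balls: prior exponent, bias and distance. -/

lemma sum_sq_mul_rpow_le {β L₀ : ℝ} {θ₀ : Seq} (h : θ₀ ∈ sobolevBall β L₀) (s : Finset ℕ) :
    ∑ i ∈ s, θ₀ i ^ 2 * ((i : ℝ) + 1) ^ (2 * β) ≤ L₀ :=
  (h.1.sum_le_tsum s fun i _ => by positivity).trans h.2.le

/-- Bounds the Gaussian exponent of the prior at `θ₀`. A factor `k` is affordable, as the box
already costs order `k log n`; it pays for one extra power of `i + 1`, so `q` may exceed `β`. -/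
lemma sum_sq_mul_rpow_le_mul {β L₀ q : ℝ} {θ₀ : Seq} (h : θ₀ ∈ sobolevBall β L₀)
    (hβq : 2 * q ≤ 2 * β + 1) (k : ℕ) :
    ∑ i ∈ Finset.range k, θ₀ i ^ 2 * ((i : ℝ) + 1) ^ (2 * q) ≤ k * L₀ := by
  refine le_trans ?_ (mul_le_mul_of_nonneg_left (sum_sq_mul_rpow_le h (Finset.range k))
    (Nat.cast_nonneg k))
  rw [Finset.mul_sum]
  refine Finset.sum_le_sum fun i hi => ?_
  have hi1 : (1 : ℝ) ≤ i + 1 := by linarith [(Nat.cast_nonneg i : (0 : ℝ) ≤ i)]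
  have hik : (i : ℝ) + 1 ≤ k := by exact_mod_cast Finset.mem_range.1 hi
  have h1 : ((i : ℝ) + 1) ^ (2 * q) ≤ ((i : ℝ) + 1) ^ (2 * β) * k :=
    calc ((i : ℝ) + 1) ^ (2 * q) ≤ ((i : ℝ) + 1) ^ (2 * β + 1) :=
          Real.rpow_le_rpow_of_exponent_le hi1 hβq
      _ = ((i : ℝ) + 1) ^ (2 * β) * (i + 1) := by
          rw [Real.rpow_add (by linarith), Real.rpow_one]
      _ ≤ _ := by gcongr
  calc θ₀ i ^ 2 * ((i : ℝ) + 1) ^ (2 * q) ≤ θ₀ i ^ 2 * (((i : ℝ) + 1) ^ (2 * β) * k) := by gcongr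
    _ = _ := by ring

lemma sum_tail_sq_le {β L₀ r : ℝ} {θ₀ : Seq} (h : θ₀ ∈ sobolevBall β L₀) (hβ : 0 ≤ β) (hr : 0 < r)
    {K : ℕ} (hK : r ≤ K) (m : ℕ) :
    ∑ i ∈ Finset.range m, (if i < K then 0 else θ₀ i ^ 2) ≤ L₀ * r ^ (-(2 * β)) := by
  refine le_trans ?_ (mul_le_mul_of_nonneg_right (sum_sq_mul_rpow_le h (Finset.range m))
    (by positivity))
  rw [Finset.sum_mul]
  refine Finset.sum_le_sum fun i _ => ?_
  split_ifs with hi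
  · positivity
  · have h1 : r ≤ (i : ℝ) + 1 := by
      have : (K : ℝ) ≤ i := by exact_mod_cast not_lt.1 hi
      linarith
    have h2 : 1 ≤ ((i : ℝ) + 1) ^ (2 * β) * r ^ (-(2 * β)) := by
      rw [Real.rpow_neg hr.le, ← div_eq_mul_inv, one_le_div (by positivity)]
      exact Real.rpow_le_rpow hr.le h1 (by linarith)
    calc θ₀ i ^ 2 = θ₀ i ^ 2 * 1 := (mul_one _).symm
      _ ≤ θ₀ i ^ 2 * (((i : ℝ) + 1) ^ (2 * β) * r ^ (-(2 * β))) := by gcongr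
      _ = _ := by ring

lemma le_sum_sq_of_le_l2DistSq {K : ℕ} {θ θ₀ : Seq} {a T : ℝ} (hθ : ∀ i, K ≤ i → θ i = 0)
    (hT : ∀ m, ∑ i ∈ Finset.range m, (if i < K then 0 else θ₀ i ^ 2) ≤ T)
    (h : ENNReal.ofReal a ≤ l2DistSq θ θ₀) :
    a ≤ ∑ i ∈ Finset.range K, (θ i - θ₀ i) ^ 2 + T := by
  have hT0 : 0 ≤ T := by simpa using hT 0
  have hA : 0 ≤ ∑ i ∈ Finset.range K, (θ i - θ₀ i) ^ 2 := Finset.sum_nonneg fun i _ => sq_nonneg _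
  rw [← ENNReal.ofReal_le_ofReal_iff (by positivity)]
  refine h.trans (ENNReal.tsum_le_of_sum_range_le fun m => ?_)
  rw [← ENNReal.ofReal_sum_of_nonneg fun i _ => sq_nonneg _]
  refine ENNReal.ofReal_le_ofReal ?_
  have h1 : ∑ i ∈ Finset.range m, (if i < K then (θ i - θ₀ i) ^ 2 else 0) ≤
      ∑ i ∈ Finset.range K, (θ i - θ₀ i) ^ 2 := by
    rw [← Finset.sum_filter]
    exact Finset.sum_le_sum_of_subset_of_nonneg (fun i hi => by simp at hi ⊢; exact hi.2)
      fun i _ _ => sq_nonneg _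
  refine le_trans ?_ (add_le_add h1 (hT m))
  rw [← Finset.sum_add_distrib]
  refine Finset.sum_le_sum fun i _ => ?_
  split_ifs with hi
  · simp
  · rw [hθ i (not_lt.1 hi)]
    simp

lemma measurableSet_le_l2DistSq (a : ℝ≥0∞) (θ₀ : Seq) : MeasurableSet {θ | a ≤ l2DistSq θ θ₀} := by
  unfold l2DistSq
  exact measurableSet_le measurable_const (by fun_prop)

/-! ### The effective dimension. -/

/-- The order `(n / log n)^{1 / (2 β + 1)}` of the dimension that balances bias and complexity. -/
def effectiveDim (n : ℕ) (β : ℝ) : ℝ := ((n : ℝ) / Real.log n) ^ (1 / (2 * β + 1))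

section effectiveDim

variable {n : ℕ} {β : ℝ}

lemma log_le_self_of_natCast (n : ℕ) : Real.log n ≤ n :=
  Real.log_le_self (Nat.cast_nonneg n)

lemma natCast_pos_of_one_le_log (hn : 1 ≤ Real.log n) : (0 : ℝ) < n := by
  linarith [log_le_self_of_natCast n]

lemma one_le_effectiveDim (hβ : 0 < β) (hn : 1 ≤ Real.log n) : 1 ≤ effectiveDim n β := by
  refine Real.one_le_rpow ?_ (by positivity)
  rw [one_le_div (by linarith)]
  exact log_le_self_of_natCast n

lemma effectiveDim_rpow (hβ : 0 < β) (hn : 1 ≤ Real.log n) :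
    effectiveDim n β ^ (2 * β + 1) = n / Real.log n := by
  have h := natCast_pos_of_one_le_log hn
  rw [effectiveDim, ← Real.rpow_mul (div_nonneg h.le (by linarith)), one_div,
    inv_mul_cancel₀ (by positivity), Real.rpow_one]

lemma natCast_mul_effectiveDim_rpow (hβ : 0 < β) (hn : 1 ≤ Real.log n) :
    n * effectiveDim n β ^ (-(2 * β)) = effectiveDim n β * Real.log n := by
  have h1 := one_le_effectiveDim hβ hn
  have h2 := effectiveDim_rpow hβ hn
  have hl : 0 < Real.log n := by linarith
  rw [Real.rpow_add (by linarith), Real.rpow_one, eq_div_iff hl.ne'] at h2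
  have h3 : 0 < effectiveDim n β ^ (2 * β) := by positivity
  rw [Real.rpow_neg (by linarith), ← div_eq_mul_inv, div_eq_iff h3.ne']
  linarith

lemma rate_one_sq (hβ : 0 < β) (hn : 1 ≤ Real.log n) :
    rate 1 β n ^ 2 = effectiveDim n β ^ (-(2 * β)) := by
  have h := natCast_pos_of_one_le_log hn
  have hd : 0 < (n : ℝ) / Real.log n := div_pos h (by linarith)
  rw [rate, one_mul, effectiveDim, ← Real.rpow_natCast, ← inv_div,
    Real.inv_rpow hd.le, ← Real.rpow_neg hd.le, ← Real.rpow_mul hd.le, ← Real.rpow_mul hd.le]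
  congr 1
  push_cast
  field_simp

lemma effectiveDim_le_half (hβ : 1 / 2 < β) (hn : 1 ≤ Real.log n) (hn4 : 4 ≤ n) :
    effectiveDim n β ≤ n / 2 := by
  have h1 := one_le_effectiveDim (by linarith : 0 < β) hn
  have h2 := effectiveDim_rpow (by linarith : 0 < β) hn
  have h4 : (4 : ℝ) ≤ n := by exact_mod_cast hn4
  have h3 : effectiveDim n β ^ (2 : ℝ) ≤ n := by
    refine (Real.rpow_le_rpow_of_exponent_le h1 (by linarith : (2 : ℝ) ≤ 2 * β + 1)).trans ?_
    rw [h2]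
    exact div_le_self (by linarith) hn
  rw [Real.rpow_two] at h3
  nlinarith

/-- Since `log log n ≤ (log n) / 2`, the logarithm of the dimension is comparable to `log n`
uniformly for `β ≤ β₂`. This is what gives the Poisson tail its factor `log n`. -/
lemma log_effectiveDim_ge {β₂ : ℝ} (hβ : 0 < β) (hβ₂ : β ≤ β₂) (hn : 1 ≤ Real.log n) :
    Real.log n / (2 * (2 * β₂ + 1)) ≤ Real.log (effectiveDim n β) := by
  have h := natCast_pos_of_one_le_log hn
  have hl : 0 < Real.log n := by linarith
  have h1 : Real.log (Real.log n) ≤ Real.log n / 2 := by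
    have h2 := Real.log_le_sub_one_of_pos (half_pos hl)
    rw [Real.log_div hl.ne' (by norm_num)] at h2
    have h3 := Real.log_le_sub_one_of_pos (by norm_num : (0 : ℝ) < 2)
    linarith
  rw [effectiveDim, Real.log_rpow (div_pos h hl), Real.log_div h.ne' hl.ne']
  calc Real.log n / (2 * (2 * β₂ + 1)) ≤ Real.log n / (2 * (2 * β + 1)) := by gcongr
    _ = 1 / (2 * β + 1) * (Real.log n - Real.log n / 2) := by field_simp; ring
    _ ≤ _ := by gcongr

end effectiveDim

/-! ### Threshold weights, prior boxes and separation at the rate. -/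

lemma exp_neg_le_poisson_weight {lam : ℝ} (hlam : 0 < lam) {n k : ℕ} (hk : 1 ≤ k) (hkn : k ≤ n)
    (hn : lam + |Real.log lam| ≤ Real.log n) :
    Real.exp (-(2 * (k * Real.log n))) ≤ Real.exp (-lam) * lam ^ k / (k.factorial : ℝ) := by
  have hn0 : (0 : ℝ) < n := by exact_mod_cast (by omega : 0 < n)
  have hk1 : (1 : ℝ) ≤ k := by exact_mod_cast hk
  have h1 : (k.factorial : ℝ) ≤ (n : ℝ) ^ k := by
    exact_mod_cast (Nat.factorial_le_pow k).trans (Nat.pow_le_pow_left hkn k)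
  have h2 : Real.exp (-lam) * lam ^ k / (n : ℝ) ^ k =
      Real.exp (-lam + k * Real.log lam - k * Real.log n) := by
    rw [Real.exp_sub, Real.exp_add, Real.exp_nat_mul, Real.exp_nat_mul, Real.exp_log hlam,
      Real.exp_log hn0]
  calc Real.exp (-(2 * (k * Real.log n)))
      ≤ Real.exp (-lam + k * Real.log lam - k * Real.log n) := by
        refine Real.exp_le_exp.2 ?_
        have h3 := neg_abs_le (Real.log lam)
        nlinarith
    _ = Real.exp (-lam) * lam ^ k / (n : ℝ) ^ k := h2.symm
    _ ≤ _ := by gcongr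

/-- From `k^k / k! ≤ e^k` the weight is at most `exp(-k (log k - log lam - 1))`, and `log k ≥ log
r`. -/
lemma poisson_weight_le {lam : ℝ} (hlam : 0 < lam) {r c : ℝ} (hr : 0 < r) {k : ℕ} (hk : r ≤ k)
    (hc : Real.log lam + 1 + c ≤ Real.log r) :
    lam ^ k / (k.factorial : ℝ) ≤ Real.exp (-(k * c)) := by
  have hk0 : (0 : ℝ) < k := hr.trans_le hk
  have h1 := Real.pow_div_factorial_le_exp (k : ℝ) hk0.le k
  have h2 : lam ^ k = (k : ℝ) ^ k * Real.exp (k * (Real.log lam - Real.log k)) := by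
    rw [Real.exp_nat_mul, ← mul_pow, Real.exp_sub, Real.exp_log hlam, Real.exp_log hk0]
    field_simp
  rw [h2, mul_div_right_comm]
  calc (k : ℝ) ^ k / (k.factorial : ℝ) * Real.exp (k * (Real.log lam - Real.log k))
      ≤ Real.exp k * Real.exp (k * (Real.log lam - Real.log k)) := by gcongr
    _ = Real.exp (k * (1 + (Real.log lam - Real.log k))) := by rw [← Real.exp_add]; ring_nf
    _ ≤ _ := by
      refine Real.exp_le_exp.2 ?_
      have h3 := Real.log_le_log hr hk
      nlinarith

lemma exp_neg_le_conditionalPrior_box {τ₀ q β L₀ : ℝ} (hτ₀ : 0 < τ₀) (hq : 0 ≤ q) (hq1 : q ≤ 1)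
    (hβ : 1 / 2 < β) {θ₀ : Seq} (hθ₀ : θ₀ ∈ sobolevBall β L₀) {n k : ℕ} (hn0 : n ≠ 0)
    (hkn : k ≤ n)
    (hn : |Real.log (2 / Real.sqrt (2 * Real.pi * τ₀))| + (L₀ + 1) / τ₀ ≤ Real.log n) :
    ENNReal.ofReal (Real.exp (-(2 * (k * Real.log n)))) ≤ conditionalPrior τ₀ q k
      (Set.pi (Finset.range k) fun i => Set.Icc (θ₀ i - (n : ℝ)⁻¹) (θ₀ i + (n : ℝ)⁻¹)) := by
  have hn1 : (0 : ℝ) < n := by exact_mod_cast Nat.pos_of_ne_zero hn0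
  refine le_trans (ENNReal.ofReal_le_ofReal ?_)
    (conditionalPrior_box_ge hτ₀ hq k θ₀ (inv_nonneg.2 hn1.le))
  have hsum : ∑ i ∈ Finset.range k, (θ₀ i ^ 2 + (n : ℝ)⁻¹ ^ 2) * ((i : ℝ) + 1) ^ (2 * q) ≤
      k * (L₀ + 1) := by
    simp_rw [add_mul]
    rw [Finset.sum_add_distrib, mul_add]
    refine add_le_add (sum_sq_mul_rpow_le_mul hθ₀ (by linarith) k) ?_
    have h1 : ∀ i ∈ Finset.range k, (n : ℝ)⁻¹ ^ 2 * ((i : ℝ) + 1) ^ (2 * q) ≤ 1 := fun i hi => by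
      have hin : (i : ℝ) + 1 ≤ n := by exact_mod_cast (Finset.mem_range.1 hi).trans_le hkn
      have h2 : ((i : ℝ) + 1) ^ (2 * q) ≤ (n : ℝ) ^ 2 :=
        calc ((i : ℝ) + 1) ^ (2 * q) ≤ ((i : ℝ) + 1) ^ (2 : ℝ) :=
              Real.rpow_le_rpow_of_exponent_le (by linarith [(Nat.cast_nonneg i : (0 : ℝ) ≤ i)])
                (by linarith)
          _ = ((i : ℝ) + 1) ^ 2 := Real.rpow_two _
          _ ≤ _ := by gcongr
      rw [inv_pow, inv_mul_le_iff₀ (by positivity), mul_one]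
      exact h2
    refine (Finset.sum_le_sum h1).trans ?_
    simp
  set c := 2 / Real.sqrt (2 * Real.pi * τ₀) with hc
  have hc0 : 0 < c := by positivity
  have h3 : 2 * (n : ℝ)⁻¹ / Real.sqrt (2 * Real.pi * τ₀) = Real.exp (Real.log c - Real.log n) := by
    rw [Real.exp_sub, Real.exp_log hc0, Real.exp_log hn1, hc]
    field_simp
  rw [h3, ← Real.exp_nat_mul, ← Real.exp_add]
  refine Real.exp_le_exp.2 ?_
  have h4 := div_le_div_of_nonneg_right hsum hτ₀.le
  rw [mul_div_assoc] at h4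
  have h5 := neg_abs_le (Real.log c)
  have h6 := mul_le_mul_of_nonneg_left hn (Nat.cast_nonneg k : (0 : ℝ) ≤ k)
  have h7 := mul_le_mul_of_nonneg_left h5 (Nat.cast_nonneg k : (0 : ℝ) ≤ k)
  linarith

/-- The bias beyond `K` uses up `L₀` of `M`; the rest follows from `‖θ - θ₀‖² ≤ 2‖x - θ‖² + 2‖x -
θ₀‖²` on the first `K` coordinates. -/
lemma sum_sq_sub_ge_of_l2DistSq_ge {n K : ℕ} {θ θ₀ x : Seq} {M L₀ e l : ℝ}
    (hl : n * e = l) (hθ : ∀ i, K ≤ i → θ i = 0)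
    (hT : ∀ m, ∑ i ∈ Finset.range m, (if i < K then 0 else θ₀ i ^ 2) ≤ L₀ * e)
    (h : ENNReal.ofReal (M * e) ≤ l2DistSq θ θ₀)
    (hx : n * ∑ i ∈ Finset.range K, (x i - θ₀ i) ^ 2 ≤ l) :
    (M - L₀) * l / 8 - l / 4 ≤ n / 4 * ∑ i ∈ Finset.range K, (x i - θ i) ^ 2 := by
  have h1 := le_sum_sq_of_le_l2DistSq hθ hT h
  have h2 : ∑ i ∈ Finset.range K, (θ i - θ₀ i) ^ 2 ≤
      2 * ∑ i ∈ Finset.range K, (x i - θ i) ^ 2 + 2 * ∑ i ∈ Finset.range K, (x i - θ₀ i) ^ 2 := by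
    rw [Finset.mul_sum, Finset.mul_sum, ← Finset.sum_add_distrib]
    refine Finset.sum_le_sum fun i _ => ?_
    nlinarith [sq_nonneg (2 * x i - θ i - θ₀ i)]
  have h3 := mul_le_mul_of_nonneg_left (h1.trans (add_le_add_left h2 _))
    (Nat.cast_nonneg n : (0 : ℝ) ≤ n)
  have h4 : n * (M * e) = M * l := by rw [← hl]; ring
  have h5 : n * (L₀ * e) = L₀ * l := by rw [← hl]; ring
  rw [mul_add, mul_add, h4, h5] at h3
  linarith

lemma tsum_ite_lt_le {s : ℕ → ℝ} {K : ℕ} {a : ℝ} (ha : 0 ≤ a)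
    (hs : ∀ k, K < k → s k ≤ a * (1 / 2) ^ k) :
    ∑' k, (if K < k then ENNReal.ofReal (s k) else 0) ≤ ENNReal.ofReal (2 * a) := by
  have h2 : HasSum (fun k : ℕ => a * (1 / 2 : ℝ) ^ k) (a * 2) := hasSum_geometric_two.mul_left a
  rw [mul_comm 2 a, ← h2.tsum_eq, ENNReal.ofReal_tsum_of_nonneg (fun k => by positivity) h2.summable]
  refine ENNReal.tsum_le_tsum fun k => ?_
  split_ifs with hk
  · exact ENNReal.ofReal_le_ofReal (hs k hk)
  · exact zero_le

/-! ### Choice of constants and the limit. -/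

theorem exists_lintegral_posterior_le {lam : ℝ} (hlam : 0 < lam) (π : Measure ℕ)
    [IsProbabilityMeasure π] {C : ℝ} (hC : 0 ≤ C)
    (hlow : ∀ k, 1 ≤ k → ENNReal.ofReal (Real.exp (-lam) * lam ^ k / (k.factorial : ℝ)) ≤ π {k})
    (hup : ∀ k, π {k} ≤ ENNReal.ofReal (C * (lam ^ k / (k.factorial : ℝ))))
    {τ₀ q : ℝ} (hτ₀ : 0 < τ₀) (hq : 1 / 2 < q) (hq' : q ≤ 1)
    {L₀ β₁ β₂ : ℝ} (hL₀ : 0 < L₀) (hβ₁ : 1 / 2 < β₁) (hβ : β₁ ≤ β₂) :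
    ∃ M₀ : ℝ, 0 < M₀ ∧ ∃ W : ℝ, ∀ M, M₀ ≤ M → ∀ n : ℕ, 4 ≤ n → W ≤ Real.log n →
      ∀ β ∈ Set.Icc β₁ β₂, ∀ θ₀ ∈ sobolevBall β L₀,
        ∫⁻ x, posterior n (sievePrior π τ₀ q) x
          {θ | ENNReal.ofReal (M * rate 1 β n ^ 2) ≤ l2DistSq θ θ₀} ∂(model n θ₀) ≤
        ENNReal.ofReal ((4 + 2 * C) * Real.exp (-(Real.log n / 8))) := by
  have hβ₂ : 0 < β₂ := by linarith
  -- Chosen so that `log r ≥ 8 b log n`: half of this gives tail weights `exp(-4 b j log n)`, the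
  -- other half absorbs `log lam + 1`.
  set b : ℝ := 1 / (16 * (2 * β₂ + 1)) with hb
  have hb0 : 0 < b := by positivity
  have hb1 : b ≤ 1 := by
    rw [hb, div_le_one (by positivity)]; linarith
  -- Evidence cost in units of `l`: 4 for the Poisson weight, 4 for the box, 3/2 for the likelihood,
  -- `L₀` for the bias.
  set C₁ : ℝ := 19 / 2 + L₀ with hC₁
  set A : ℝ := (C₁ + L₀ + 1) / b with hA
  have hA1 : 1 ≤ A := by
    rw [hA, one_le_div hb0]; linarith
  have hbA : b * A = C₁ + L₀ + 1 := by rw [hA]; field_simp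
  set W₁ : ℝ := lam + |Real.log lam|
  set W₂ : ℝ := |Real.log (2 / Real.sqrt (2 * Real.pi * τ₀))| + (L₀ + 1) / τ₀
  set W₃ : ℝ := (Real.log lam + 1) / (4 * b)
  -- With this `M₀`, `Y ≥ (C₁ + 7/4) l`, which exceeds `C₁ l + K` because the condition `16 * A ≤
  -- log n` forces `K ≤ l / 8`.
  refine ⟨L₀ + 8 * (C₁ + 2), by positivity,
    max 1 (max W₁ (max W₂ (max W₃ (max (1 / b) (16 * A))))), ?_⟩
  intro M hM n hn4 hW β hβI θ₀ hθ₀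
  simp only [max_le_iff] at hW
  obtain ⟨hn1, hW1, hW2, hW3, hW4, hW5⟩ := hW
  have hβ12 : 1 / 2 < β := hβ₁.trans_le hβI.1
  have hβ0 : 0 < β := by linarith
  have hn0 : n ≠ 0 := by omega
  have hnpos : (0 : ℝ) < n := by exact_mod_cast Nat.pos_of_ne_zero hn0
  have hr1 := one_le_effectiveDim hβ0 hn1
  have hrn := effectiveDim_le_half hβ12 hn1 hn4
  have hrlog := log_effectiveDim_ge hβ0 hβI.2 hn1
  have hnr := natCast_mul_effectiveDim_rpow hβ0 hn1
  rw [rate_one_sq hβ0 hn1]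
  set r := effectiveDim n β
  set Λ := Real.log n
  set l := r * Λ with hl
  have hlΛ : Λ ≤ l := le_mul_of_one_le_left (by linarith) hr1
  have hr0 : 0 < r := by linarith
  set k := ⌈r⌉₊ with hk
  set K := ⌈A * r⌉₊ with hK
  have hrAr : r ≤ A * r := le_mul_of_one_le_left hr0.le hA1
  have hkK : k ≤ K := Nat.ceil_mono hrAr
  have hrk : r ≤ k := Nat.le_ceil r
  have hk2 : (k : ℝ) ≤ 2 * r := by linarith [Nat.ceil_lt_add_one hr0.le]
  have hk1 : 1 ≤ k := Nat.one_le_ceil_iff.2 hr0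
  have hArK : A * r ≤ K := Nat.le_ceil _
  have hrK : r ≤ K := hrAr.trans hArK
  have hK2 : (K : ℝ) ≤ 2 * (A * r) := by
    linarith [Nat.ceil_lt_add_one (by positivity : 0 ≤ A * r)]
  have hkn : k ≤ n := by
    have : (k : ℝ) ≤ n := by linarith
    exact_mod_cast this
  have hKl : (K : ℝ) ≤ l / 8 := by
    have h1 : 16 * A * r ≤ Λ * r := mul_le_mul_of_nonneg_right hW5 hr0.le
    rw [hl]; linarith
  have htail : ∀ (J : ℕ), r ≤ J → ∀ m,
      n * ∑ i ∈ Finset.range m, (if i < J then 0 else θ₀ i ^ 2) ≤ L₀ * l := fun J hJ m => by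
    refine (mul_le_mul_of_nonneg_left (sum_tail_sq_le hθ₀ hβ0.le hr0 hJ m) hnpos.le).trans
      (le_of_eq ?_)
    rw [← hnr]; ring
  have hevidence : ∀ x : Seq, n * ∑ i ∈ Finset.range K, (x i - θ₀ i) ^ 2 ≤ l →
      ENNReal.ofReal (Real.exp (-(C₁ * l))) * likelihoodRatio n K 0 θ₀ x ≤
        ∫⁻ θ, likelihood n θ x ∂(sievePrior π τ₀ q) := by
    intro x hx
    have hδ : (n : ℝ) * (k * (n : ℝ)⁻¹ ^ 2) ≤ l := by
      have h1 : (n : ℝ) * (k * (n : ℝ)⁻¹ ^ 2) = k / n := by field_simp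
      rw [h1]
      have h2 : (k : ℝ) / n ≤ 1 := (div_le_one hnpos).2 (by exact_mod_cast hkn)
      linarith
    refine le_trans ?_ (evidence_ge π τ₀ q hkK θ₀ x hx (htail k hrk K) hδ)
    gcongr
    have h1 := (ENNReal.ofReal_le_ofReal (exp_neg_le_poisson_weight hlam hk1 hkn hW1)).trans
      (hlow k hk1)
    have h2 := exp_neg_le_conditionalPrior_box hτ₀ (by linarith : 0 ≤ q) hq' hβ12 hθ₀ hn0 hkn hW2
    refine le_trans ?_ (mul_le_mul_left (mul_le_mul' h1 h2) _)
    rw [← ENNReal.ofReal_mul (Real.exp_nonneg _), ← ENNReal.ofReal_mul (by positivity),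
      ← Real.exp_add, ← Real.exp_add]
    refine ENNReal.ofReal_le_ofReal (Real.exp_le_exp.2 ?_)
    have h3 : (k : ℝ) * Λ ≤ 2 * l := by
      rw [hl, ← mul_assoc]
      exact mul_le_mul_of_nonneg_right hk2 (by linarith)
    rw [hC₁]
    linarith
  set s : ℕ → ℝ := fun j => Real.exp (-(2 * b * (j * Λ))) with hs
  have hsup : ∀ j, K < j → 0 < s j ∧ π {j} ≤ ENNReal.ofReal (C * s j ^ 2) := by
    intro j hj
    refine ⟨Real.exp_pos _, (hup j).trans (ENNReal.ofReal_le_ofReal ?_)⟩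
    gcongr
    have hrj : r ≤ j := hrK.trans (by exact_mod_cast hj.le)
    refine (poisson_weight_le hlam hr0 hrj (c := 4 * b * Λ) ?_).trans (le_of_eq ?_)
    · have h1 : Real.log lam + 1 ≤ Λ * (4 * b) := (div_le_iff₀ (by positivity)).1 hW3
      have h2 : Λ / (2 * (2 * β₂ + 1)) = 8 * b * Λ := by
        rw [hb]; field_simp; norm_num
      linarith
    · rw [hs, ← Real.exp_nat_mul]
      congr 1
      push_cast
      ring
  have hmain := lintegral_posterior_le hn0 π τ₀ q θ₀
    (B := {θ | ENNReal.ofReal (M * r ^ (-(2 * β))) ≤ l2DistSq θ θ₀})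
    (measurableSet_le_l2DistSq _ _) K (l := l) (E := C₁ * l) (Y := (M - L₀) * l / 8 - l / 4)
    (T := L₀ * l) hC hevidence
    (fun θ hθ hθ0 x hx => sum_sq_sub_ge_of_l2DistSq_ge hnr hθ0
      (sum_tail_sq_le hθ₀ hβ0.le hr0 hrK) hθ hx)
    (htail K hrK) hsup
  refine hmain.trans ?_
  have hexp : ∀ j, K < j → s j * (1 + C * Real.exp (C₁ * l + L₀ * l)) ≤
      (1 + C) * Real.exp (-(l / 8)) * (1 / 2) ^ j := by
    intro j hj
    have hbΛ : 1 ≤ b * Λ := by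
      rw [div_le_iff₀ hb0] at hW4; linarith
    have hKj : (K : ℝ) ≤ j := by exact_mod_cast hj.le
    -- Half of the exponent of `s j` offsets evidence and bias costs through `j ≥ A r` and `b * A =
    -- C₁ + L₀ + 1`; the other half makes the series geometric.
    have h1 : s j ≤ Real.exp (-((C₁ + L₀ + 1) * l)) * (1 / 2) ^ j := by
      have h2 : s j = Real.exp (-(b * (j * Λ))) * Real.exp (j * (-(b * Λ))) := by
        rw [hs, ← Real.exp_add]; ring_nf
      rw [h2]
      refine mul_le_mul (Real.exp_le_exp.2 ?_) ?_ (Real.exp_nonneg _) (Real.exp_nonneg _)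
      · rw [hl, ← hbA]
        have h3 : A * r * Λ ≤ j * Λ := mul_le_mul_of_nonneg_right (hArK.trans hKj) (by linarith)
        have h4 := mul_le_mul_of_nonneg_left h3 hb0.le
        linarith
      · rw [Real.exp_nat_mul]
        gcongr
        rw [Real.exp_neg, one_div]
        gcongr
        linarith [Real.add_one_le_exp (b * Λ)]
    have hl0 : 0 ≤ (C₁ + L₀) * l := by positivity
    have h5 : 1 + C * Real.exp (C₁ * l + L₀ * l) ≤ (1 + C) * Real.exp ((C₁ + L₀) * l) := by
      rw [← add_mul C₁ L₀ l]
      linarith [Real.one_le_exp hl0]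
    calc s j * (1 + C * Real.exp (C₁ * l + L₀ * l))
        ≤ Real.exp (-((C₁ + L₀ + 1) * l)) * (1 / 2) ^ j * ((1 + C) * Real.exp ((C₁ + L₀) * l)) := by
          gcongr
      _ = (1 + C) * (Real.exp (-((C₁ + L₀ + 1) * l)) * Real.exp ((C₁ + L₀) * l)) * (1 / 2) ^ j := by
          ring
      _ = (1 + C) * Real.exp (-l) * (1 / 2) ^ j := by
          rw [← Real.exp_add]; ring_nf
      _ ≤ _ := by
          gcongr
          linarith
  refine (add_le_add le_rfl (tsum_ite_lt_le (by positivity) hexp)).trans ?_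
  rw [← ENNReal.ofReal_add (Real.exp_nonneg _) (Real.exp_nonneg _),
    ← ENNReal.ofReal_add (by positivity) (by positivity)]
  refine ENNReal.ofReal_le_ofReal ?_
  have h1 : Real.exp (K - l / 4) ≤ Real.exp (-(Λ / 8)) := Real.exp_le_exp.2 (by linarith)
  have h2 : Real.exp (C₁ * l + K - ((M - L₀) * l / 8 - l / 4)) ≤ Real.exp (-(Λ / 8)) := by
    refine Real.exp_le_exp.2 ?_
    have h3 : 8 * (C₁ + 2) * l ≤ (M - L₀) * l :=
      mul_le_mul_of_nonneg_right (by linarith) (by linarith)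
    linarith
  have h4 : (1 + C) * Real.exp (-(l / 8)) ≤ (1 + C) * Real.exp (-(Λ / 8)) := by
    gcongr
  linarith

end WhiteNoise

end

theorem mainTheorem4
    (lam : ℝ≥0) (hlam : 0 < lam)
    (π : Measure ℕ)
    (hπ : π = poissonMeasure lam ∨ π = ProbabilityTheory.cond (poissonMeasure lam) (Set.Ici 1))
    (τ₀ q : ℝ) (hτ₀ : 0 < τ₀) (hq : 1 / 2 < q) (hq' : q ≤ 1)
    (L₀ β₁ β₂ : ℝ) (hL₀ : 0 < L₀) (hβ₁ : 1 / 2 < β₁) (hβ : β₁ ≤ β₂) :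
    ∃ ε₀ : ℝ, 0 < ε₀ ∧ ∃ M₀ : ℝ, 0 < M₀ ∧ ∀ M : ℝ, M₀ ≤ M →
      Tendsto
        (fun n : ℕ => ⨆ β ∈ Set.Icc β₁ β₂, ⨆ θ₀ ∈ WhiteNoise.sobolevBall β L₀,
          ∫⁻ x, WhiteNoise.posterior n (WhiteNoise.sievePrior π τ₀ q) x
              {θ | ENNReal.ofReal (M * WhiteNoise.rate ε₀ β n ^ 2) ≤ WhiteNoise.l2DistSq θ θ₀}
            ∂(WhiteNoise.model n θ₀))
        atTop (𝓝 0) := by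
  have hlam' : (0 : ℝ) < lam := by exact_mod_cast hlam
  -- Both threshold priors enter only through these bounds. Conditioning multiplies the weights with
  -- `k ≥ 1` by a constant at least one; the lower bound omits `k = 0`, which conditioning removes.
  have hweights : IsProbabilityMeasure π ∧ ∃ C : ℝ, 0 ≤ C ∧
      (∀ k, 1 ≤ k →
        ENNReal.ofReal (Real.exp (-lam) * (lam : ℝ) ^ k / (k.factorial : ℝ)) ≤ π {k}) ∧
      ∀ k, π {k} ≤ ENNReal.ofReal (C * ((lam : ℝ) ^ k / (k.factorial : ℝ))) := by
    rcases hπ with rfl | rfl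
    · refine ⟨inferInstance, Real.exp (-lam), Real.exp_nonneg _, fun k _ => ?_, fun k => ?_⟩
      · rw [poissonMeasure_singleton]
      · rw [poissonMeasure_singleton, mul_div_assoc]
    · set p := poissonMeasure lam
      have hp0 : p (Set.Ici 1) ≠ 0 := by
        have h1 : p {1} ≤ p (Set.Ici 1) := measure_mono (by simp)
        have h2 : 0 < p {1} := by
          rw [poissonMeasure_singleton, ENNReal.ofReal_pos]
          positivity
        exact (h2.trans_le h1).ne'
      have hinv : (p (Set.Ici 1))⁻¹ ≠ ∞ := ENNReal.inv_ne_top.2 hp0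
      refine ⟨cond_isProbabilityMeasure hp0, (p (Set.Ici 1))⁻¹.toReal * Real.exp (-lam),
        by positivity, fun k hk => ?_, fun k => ?_⟩
      · rw [cond_apply measurableSet_Ici, ← poissonMeasure_singleton,
          Set.inter_eq_self_of_subset_right (by simpa using hk)]
        exact le_mul_of_one_le_left zero_le (ENNReal.one_le_inv.2 prob_le_one)
      · rw [cond_apply measurableSet_Ici, mul_assoc, ENNReal.ofReal_mul ENNReal.toReal_nonneg,
          ENNReal.ofReal_toReal hinv, ← mul_div_assoc, ← poissonMeasure_singleton]
        exact mul_le_mul_right (measure_mono Set.inter_subset_right) _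
  obtain ⟨hprob, C, hC, hlow, hup⟩ := hweights
  obtain ⟨M₀, hM₀, W, hW⟩ :=
    WhiteNoise.exists_lintegral_posterior_le hlam' π hC hlow hup hτ₀ hq hq' hL₀ hβ₁ hβ
  refine ⟨1, one_pos, M₀, hM₀, fun M hM => ?_⟩
  have hlog : Tendsto (fun n : ℕ => Real.log n) atTop atTop :=
    Real.tendsto_log_atTop.comp tendsto_natCast_atTop_atTop
  have hlim : Tendsto (fun n : ℕ => ENNReal.ofReal ((4 + 2 * C) * Real.exp (-(Real.log n / 8))))
      atTop (𝓝 0) := by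
    have h1 : Tendsto (fun n : ℕ => (4 + 2 * C) * Real.exp (-(Real.log n / 8))) atTop (𝓝 0) := by
      simpa using (Real.tendsto_exp_neg_atTop_nhds_zero.comp
        (hlog.atTop_div_const (by norm_num : (0 : ℝ) < 8))).const_mul (4 + 2 * C)
    simpa using ENNReal.tendsto_ofReal h1
  refine tendsto_of_tendsto_of_tendsto_of_le_of_le' tendsto_const_nhds hlim
    (Eventually.of_forall fun n => zero_le) ?_
  filter_upwards [eventually_ge_atTop 4, hlog.eventually_ge_atTop W] with n hn4 hnW
  exact iSup₂_le fun β hβI => iSup₂_le fun θ₀ hθ₀ => hW M hM n hn4 hnW β hβI θ₀ hθ₀
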